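/- **Setting on the indexing side.** An *indexing category* is a small category with pullbacks in which every endomorphism is an isomorphism and in which every comma category $\mathcal I\downarrow a$ has a skeleton with finitely many objects. Let $\mathcal U$ be a small category with subcategories $\mathcal I$ and $\mathcal A$ having the same objects as $\mathcal U$, such that every map of $\mathcal U$ is a composite $i\circ\alpha$ with $i\in\mathcal I$, $\alpha\in\mathcal A$, the category $\mathcal I$ is an indexing category, and every isomorphism of $\mathcal I$ is an isomorphism of $\mathcal A$. The factorization $\mathcal U=\mathcal I\circ\mathcal A$ *admits conjugation* if (1) whenever $i\alpha=j\beta$ with $\alpha,\beta\in\mathcal A$ and $i,j\in\mathcal I$, there is an isomorphism $\varphi$ of $\mathcal I$ with $\varphi\beta=\alpha$ and $i\varphi=j$; and (2) every $\alpha\in\mathcal A$ has a pullback in $\mathcal U$ along every $i\in\mathcal I$ with the same codomain, in which the map parallel to $\alpha$ lies in $\mathcal A$ and the map parallel to $i$ lies in $\mathcal I$, and the isomorphism between two such pullback squares is an isomorphism of $\mathcal I$. The category $\mathcal I\circ\mathcal A\circ\mathcal I^{\mathrm{op}}$ has the objects of $\mathcal U$; its morphisms $a\to b$ are the diagrams $a\xleftarrow{\,i\,}a_1\xrightarrow{\,\alpha\,}b_1\xrightarrow{\,j\,}b$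 with $i,j\in\mathcal I$, $\alpha\in\mathcal A$, written $j\alpha i^*$, modulo isomorphisms of $\mathcal I$ at $a_1$ and $b_1$. The composite $(l\gamma k^*)\circ(j\alpha i^*)$ is $(lj'')(\gamma'\alpha')(ik'')^*$, where $k'$, $j'$ are the projections of the pullback in $\mathcal I$ of $j$ and $k$ (with $jk'=kj'$), $\alpha'\in\mathcal A$, $k''\in\mathcal I$ form the pullback in (2) of $\alpha$ along $k'$ (with $\alpha k''=k'\alpha'$), and $\gamma j'=j''\gamma'$ with $j''\in\mathcal I$, $\gamma'\in\mathcal A$. A *conjugate pair* is a pair $(\mathcal B,\mathcal A)$ of small categories with $\mathcal A$ as above and $\mathcal B$ equivalent to $\mathcal I\circ\mathcal A\circ\mathcal I^{\mathrm{op}}$ for such a factorization. A map of $\mathcal B$ is *regular* if it lies in $\mathcal U$, i.e. is of the form $j\alpha 1^*$, and *singular* otherwise. **The functor $\mathcal R$.** Let $\mathcal U(a,b)_+$ be $\mathcal B(a,b)$ with all singular maps identified to a basepoint (equivalently, the set of regular maps with a disjoint basepoint); composition makes this a functor $\mathcal A^{\mathrm{op}}\times\mathcal B\to\mathrm{Sets}_*$.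 For a pointed category $\mathcal C$ with small limits and $G:\mathcal A^{\mathrm{op}}\to\mathcal C$, define $\mathcal RG:\mathcal B^{\mathrm{op}}\to\mathcal C$ by letting $\mathcal RG(b)$ be the end of $(x,y)\mapsto\prod_{\mathcal U(y,b)_+}G(x)$ over $\mathcal A$, where a product over a based set has one factor for each element other than the basepoint. **Setting on the model category side.** Here a *model category* is a pointed, proper, cofibrantly generated model category $\mathcal C$ with all small limits and colimits, in which the projections of binary products $X\times Y$ are fibrations, binary products of acyclic fibrations are weak equivalences, and binary coproducts of acyclic cofibrations are weak equivalences. For small $\mathcal D$, the category $[\mathcal D^{\mathrm{op}},\mathcal C]$ carries the projective model structure: weak equivalences and fibrations are objectwise. $\mathcal C$ is *semi-stable* if moreover: * (Lower Triangular Axiom) if $A_1,A_2$ are cofibrant and $f:A_1\vee A_2\to A_1\times A_2$ has components $f_{ij}:A_i\to A_j$ with $f_{11},f_{22}$ weak equivalences and $f_{12}=0$, then $f$ is a weak equivalence; * (Pushout-Product Coherence) the product of two homotopy pushout squares is a homotopy pushout square; * (Colimit-Product Coherence) for every ordinal $\lambda$ and all cofibrant $\lambda$-sequences $X,Y:\lambda\to\mathcal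 C$ (cofibrant in the projective model structure), the natural map $\mathrm{hocolim}(X\times Y)\to\mathrm{hocolim}(X)\times\mathrm{hocolim}(Y)$ is an isomorphism in the homotopy category, where $\mathrm{hocolim}$ is the colimit of a cofibrant replacement. **Corollary.** Let $\mathcal C$ be a semi-stable model category, let $(\mathcal B,\mathcal A)$ be a conjugate pair, and let $\tau:F\to G$ be a natural transformation of functors $\mathcal A^{\mathrm{op}}\to\mathcal C$ with $F$ cofibrant in $[\mathcal A^{\mathrm{op}},\mathcal C]$. Then $\tau$ is a weak equivalence if and only if $\mathcal R\tau$ is a weak equivalence in $[\mathcal B^{\mathrm{op}},\mathcal C]$. -/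

import Mathlib

open CategoryTheory CategoryTheory.Limits HomotopicalAlgebra Opposite

universe w v u

/-! ### Indexing categories and factorizations admitting conjugation -/

namespace ConjugatePairs

/-- An indexing category: an EI-category with pullbacks all of whose comma categories `J ↓ a`
have a skeleton with finitely many objects. -/
structure IsIndexingCategory (J : Type u) [Category.{v} J] : Prop where
  isIso_endo : ∀ {a : J} (f : a ⟶ a), IsIso f
  hasPullbacks : HasPullbacks J
  finite_skeleton : ∀ a : J, Finite (Skeleton (Over a))

/-- The wide subcategories of `U` with classes of morphisms `I` and `A` give a factorization
`U = I ∘ A` which admits conjugation. -/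
class AdmitsConjugation {U : Type w} [SmallCategory.{w} U] (I A : MorphismProperty U)
    [I.IsMultiplicative] [A.IsMultiplicative] : Prop where
  indexing : IsIndexingCategory (WideSubcategory I)
  /-- `Iso(I) ⊆ Iso(A)` -/
  iso_mem : ∀ {a b : U} (e : a ≅ b), I e.hom → I e.inv → A e.hom ∧ A e.inv
  /-- `U` factors as `I ∘ A` -/
  exists_fac : ∀ {a b : U} (f : a ⟶ b),
    ∃ (c : U) (p : a ⟶ c) (q : c ⟶ b), A p ∧ I q ∧ p ≫ q = f
  /-- the factorization is unique up to lifting isomorphisms in `I` -/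
  exists_lift : ∀ {a b c d : U} (α : a ⟶ b) (i : b ⟶ d) (β : a ⟶ c) (j : c ⟶ d),
    A α → I i → A β → I j → α ≫ i = β ≫ j →
      ∃ φ : c ≅ b, I φ.hom ∧ I φ.inv ∧ β ≫ φ.hom = α ∧ φ.hom ≫ i = j
  /-- maps in `A` can be pulled back (in `U`) along maps in `I` -/
  exists_pullback : ∀ {a b c : U} (α : a ⟶ b) (i : c ⟶ b), A α → I i →
    ∃ (p : U) (i' : p ⟶ a) (α' : p ⟶ c), I i' ∧ A α' ∧ IsPullback i' α' α i
  /-- the isomorphism relating two such pullback squares is an isomorphism in `I` -/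
  pullback_unique : ∀ {a b c p q : U} (α : a ⟶ b) (i : c ⟶ b) (i₁ : p ⟶ a) (α₁ : p ⟶ c)
    (i₂ : q ⟶ a) (α₂ : q ⟶ c), A α → I i → I i₁ → A α₁ → I i₂ → A α₂ →
    IsPullback i₁ α₁ α i → IsPullback i₂ α₂ α i →
    ∀ θ : p ≅ q, θ.hom ≫ i₂ = i₁ → θ.hom ≫ α₂ = α₁ → I θ.hom ∧ I θ.inv

variable {U : Type w} [SmallCategory.{w} U] {I A : MorphismProperty U}
  [I.IsMultiplicative] [A.IsMultiplicative]

/-- A map of `U` lying in `I`, as a morphism of the wide subcategory `I`. -/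
def wideHom {x y : U} (f : x ⟶ y) (hf : I f) : (⟨x⟩ : WideSubcategory I) ⟶ ⟨y⟩ := ⟨f, hf⟩

@[simp]
lemma wideHom_hom {x y : U} (f : x ⟶ y) (hf : I f) : (wideHom f hf).hom = f := rfl

section Basic

/-- If `i` and `i ∘ f` lie in `I`, then so does `f`. -/
lemma mem_of_comp (A : MorphismProperty U) [A.IsMultiplicative] [AdmitsConjugation I A]
    {a b c : U} (f : a ⟶ b) (i : b ⟶ c) (hi : I i) (hfi : I (f ≫ i)) : I f := by
  obtain ⟨m, d, e, hd, he, rfl⟩ := AdmitsConjugation.exists_fac (I := I) (A := A) f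
  obtain ⟨φ, h1, -, h3, -⟩ := AdmitsConjugation.exists_lift (I := I) (A := A) d (e ≫ i) (𝟙 a)
    ((d ≫ e) ≫ i) hd (I.comp_mem _ _ he hi) (A.id_mem a) hfi (by simp)
  simp only [Category.id_comp] at h3
  exact I.comp_mem _ _ (h3 ▸ h1) he

lemma mono_in_indexing {J : Type u} [Category.{v} J] (h : IsIndexingCategory J) {x y : J}
    (i : x ⟶ y) : Mono i := by
  have := h.hasPullbacks
  have e1 : pullback.diagonal i ≫ pullback.fst i i = 𝟙 x := by simp
  have e2 : pullback.diagonal i ≫ pullback.snd i i = 𝟙 x := by simp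
  have key : ∀ p : pullback.diagonalObj i ⟶ x, pullback.diagonal i ≫ p = 𝟙 x →
      p ≫ pullback.diagonal i = 𝟙 _ := by
    intro p hp
    have := h.isIso_endo (p ≫ pullback.diagonal i)
    rw [← cancel_mono (p ≫ pullback.diagonal i)]
    simp [reassoc_of% hp]
  have e3 : pullback.fst i i = pullback.snd i i := by
    have h1 := key _ e1
    have : pullback.fst i i = pullback.fst i i ≫ pullback.diagonal i ≫ pullback.snd i i := by
      rw [e2, Category.comp_id]
    rw [this, reassoc_of% h1]
  constructor
  intro z f g hfg
  rw [← pullback.lift_fst f g hfg, e3, pullback.lift_snd]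

/-- Maps in `I` are monomorphisms of `U`. -/
lemma cancel_index (A : MorphismProperty U) [A.IsMultiplicative] [AdmitsConjugation I A]
    {t x y : U} (f g : t ⟶ x) (i : x ⟶ y) (hi : I i) (h : f ≫ i = g ≫ i) : f = g := by
  obtain ⟨m, d, c, hd, hc, rfl⟩ := AdmitsConjugation.exists_fac (I := I) (A := A) f
  obtain ⟨m', d', c', hd', hc', rfl⟩ := AdmitsConjugation.exists_fac (I := I) (A := A) g
  obtain ⟨φ, h1, -, h3, h4⟩ := AdmitsConjugation.exists_lift (I := I) (A := A) d (c ≫ i) d'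
    (c' ≫ i) hd (I.comp_mem _ _ hc hi) hd' (I.comp_mem _ _ hc' hi) (by simpa using h)
  have hmono := mono_in_indexing (AdmitsConjugation.indexing (I := I) (A := A))
    (wideHom i hi)
  have : wideHom (φ.hom ≫ c) (I.comp_mem _ _ h1 hc) = wideHom c' hc' := by
    rw [← cancel_mono (wideHom i hi)]
    ext
    simpa using h4
  have h5 : φ.hom ≫ c = c' := congrArg (fun k => k.hom) this
  rw [← h3, ← h5, Category.assoc]

/-- Pullbacks in the indexing category are pullbacks in `U`. -/
lemma isPullback_of_indexing (A : MorphismProperty U) [A.IsMultiplicative]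
    [AdmitsConjugation I A] {q x y b : WideSubcategory I} {f : q ⟶ x} {g : q ⟶ y} {j : x ⟶ b}
    {k : y ⟶ b} (h : IsPullback f g j k) : IsPullback f.hom g.hom j.hom k.hom := by
  have hw : f.hom ≫ j.hom = g.hom ≫ k.hom := congrArg (fun k => k.hom) h.w
  refine ⟨⟨hw⟩, ⟨PullbackCone.IsLimit.mk hw (fun s => ?_) ?_ ?_ ?_⟩⟩
  · exact (show ∃ l : s.pt ⟶ q.obj, l ≫ f.hom = s.fst ∧ l ≫ g.hom = s.snd by
      obtain ⟨m, d, c, hd, hc, e1⟩ := AdmitsConjugation.exists_fac (I := I) (A := A) s.fst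
      obtain ⟨m', d', c', hd', hc', e2⟩ := AdmitsConjugation.exists_fac (I := I) (A := A) s.snd
      obtain ⟨φ, h1, -, h3, h4⟩ := AdmitsConjugation.exists_lift (I := I) (A := A)
        d' (c' ≫ k.hom) d (c ≫ j.hom) hd' (I.comp_mem _ _ hc' k.property) hd
        (I.comp_mem _ _ hc j.property)
        (by rw [reassoc_of% e1, reassoc_of% e2, s.condition])
      let l : (⟨m⟩ : WideSubcategory I) ⟶ q := h.lift (wideHom c hc)
        (wideHom (φ.hom ≫ c') (I.comp_mem _ _ h1 hc')) (by ext; simpa using h4.symm)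
      have l1 : l.hom ≫ f.hom = c :=
        congrArg (fun k : (⟨m⟩ : WideSubcategory I) ⟶ x => k.hom) (h.lift_fst _ _ _)
      have l2 : l.hom ≫ g.hom = φ.hom ≫ c' :=
        congrArg (fun k : (⟨m⟩ : WideSubcategory I) ⟶ y => k.hom) (h.lift_snd _ _ _)
      exact ⟨d ≫ l.hom, by rw [Category.assoc, l1, e1],
        by rw [Category.assoc, l2, reassoc_of% h3, e2]⟩).choose
  · intro s
    exact (Exists.choose_spec (p := fun l : s.pt ⟶ q.obj => l ≫ f.hom = s.fst ∧ l ≫ g.hom = s.snd)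
      _).1
  · intro s
    exact (Exists.choose_spec (p := fun l : s.pt ⟶ q.obj => l ≫ f.hom = s.fst ∧ l ≫ g.hom = s.snd)
      _).2
  · intro s m hm1 _
    refine cancel_index (I := I) A _ _ f.hom f.property ?_
    rw [hm1]
    exact (Exists.choose_spec (p := fun l : s.pt ⟶ q.obj => l ≫ f.hom = s.fst ∧ l ≫ g.hom = s.snd)
      _).1.symm

end Basic

/-! ### The category `B = I ∘ A ∘ Iᵒᵖ` of a factorization admitting conjugation -/

variable (I A) in
/-- A diagram `a ⟵ src ⟶ tgt ⟶ b` representing a morphism `im ∘ mid ∘ coker*` from `a` to `b`,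
the outer two maps lying in `I` and the middle one in `A`. -/
structure Diagram (a b : U) where
  src : U
  tgt : U
  coker : src ⟶ a
  mid : src ⟶ tgt
  im : tgt ⟶ b
  coker_mem : I coker
  mid_mem : A mid
  im_mem : I im

namespace Diagram

/-- Two diagrams represent the same morphism if they are related by isomorphisms in `I`. -/
def Rel {a b : U} (d e : Diagram I A a b) : Prop :=
  ∃ (φ : d.src ≅ e.src) (ψ : d.tgt ≅ e.tgt), I φ.hom ∧ I φ.inv ∧ I ψ.hom ∧ I ψ.inv ∧
    φ.hom ≫ e.coker = d.coker ∧ d.mid ≫ ψ.hom = φ.hom ≫ e.mid ∧ ψ.hom ≫ e.im = d.im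

variable (I A) in
/-- The equivalence relation on diagrams whose classes are the morphisms of `B`. -/
def setoid (a b : U) : Setoid (Diagram I A a b) where
  r := Rel
  iseqv :=
    { refl := fun d => ⟨Iso.refl _, Iso.refl _, I.id_mem _, I.id_mem _, I.id_mem _, I.id_mem _,
        by simp, by simp, by simp⟩
      symm := by
        rintro d e ⟨φ, ψ, h1, h2, h3, h4, h5, h6, h7⟩
        refine ⟨φ.symm, ψ.symm, h2, h1, h4, h3, ?_, ?_, ?_⟩
        · simp [← h5]
        · rw [← cancel_epi φ.hom, ← cancel_mono ψ.hom]
          simp [h6]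
        · simp [← h7]
      trans := by
        rintro d e f ⟨φ, ψ, h1, h2, h3, h4, h5, h6, h7⟩ ⟨φ', ψ', h1', h2', h3', h4', h5', h6', h7'⟩
        refine ⟨φ ≪≫ φ', ψ ≪≫ ψ', I.comp_mem _ _ h1 h1', I.comp_mem _ _ h2' h2,
          I.comp_mem _ _ h3 h3', I.comp_mem _ _ h4' h4, ?_, ?_, ?_⟩
        · simp [h5, h5']
        · simp [reassoc_of% h6, h6']
        · simp [h7, h7'] }

variable (I A) in
/-- The diagram `a = a ⟶ tgt ⟶ b` of a map `a ⟶ b` of `U` factored as `mid ≫ im`. -/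
@[simps]
def ofFac {a b : U} (c : U) (p : a ⟶ c) (q : c ⟶ b) (hp : A p) (hq : I q) :
    Diagram I A a b where
  src := a
  tgt := c
  coker := 𝟙 a
  mid := p
  im := q
  coker_mem := I.id_mem a
  mid_mem := hp
  im_mem := hq

variable (I A) in
/-- The identity diagram. -/
def id (a : U) : Diagram I A a a := ofFac I A a (𝟙 a) (𝟙 a) (A.id_mem a) (I.id_mem a)

/-- The data from which a composite of diagrams `a ⟶ b` and `b ⟶ c` is formed: the pullback `q`
(in `I`) of the image of `d` along the cokernel of `e`, the pullback `p` (in `U`) of the middle map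
of `d` along `q ⟶ d.tgt`, and a factorization of `q ⟶ e.src ⟶ e.tgt`. -/
structure CompData {a b c : U} (d : Diagram I A a b) (e : Diagram I A b c) where
  q : WideSubcategory I
  k' : q ⟶ ⟨d.tgt⟩
  j' : q ⟶ ⟨e.src⟩
  isPullback : IsPullback k' j' (wideHom d.im d.im_mem) (wideHom e.coker e.coker_mem)
  p : U
  k'' : p ⟶ d.src
  α' : p ⟶ q.obj
  k''_mem : I k''
  α'_mem : A α'
  isPullback' : IsPullback k'' α' d.mid k'.hom
  r : U
  γ' : q.obj ⟶ r
  j'' : r ⟶ e.tgt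
  γ'_mem : A γ'
  j''_mem : I j''
  fac : γ' ≫ j'' = j'.hom ≫ e.mid

/-- The composite diagram `(l j'') ∘ (γ' α') ∘ (i k'')*`. -/
@[simps]
def CompData.composite {a b c : U} {d : Diagram I A a b} {e : Diagram I A b c}
    (X : CompData d e) : Diagram I A a c where
  src := X.p
  tgt := X.r
  coker := X.k'' ≫ d.coker
  mid := X.α' ≫ X.γ'
  im := X.j'' ≫ e.im
  coker_mem := I.comp_mem _ _ X.k''_mem d.coker_mem
  mid_mem := A.comp_mem _ _ X.α'_mem X.γ'_mem
  im_mem := I.comp_mem _ _ X.j''_mem e.im_mem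

/-- The map of `U` underlying the last two legs of a diagram. -/
def leg {a b : U} (d : Diagram I A a b) : d.src ⟶ b := d.mid ≫ d.im

/-- `c` is a composite of `d` and `e`, viewed as spans in `U`. -/
def IsSpanComp {a b c : U} (d : Diagram I A a b) (e : Diagram I A b c)
    (x : Diagram I A a c) : Prop :=
  ∃ (f : x.src ⟶ d.src) (g : x.src ⟶ e.src), IsPullback f g d.leg e.coker ∧
    f ≫ d.coker = x.coker ∧ g ≫ e.leg = x.leg

lemma Rel.leg {a b : U} {d e : Diagram I A a b} (h : Rel d e) :
    ∃ φ : d.src ≅ e.src, φ.hom ≫ e.coker = d.coker ∧ φ.hom ≫ e.leg = d.leg := by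
  obtain ⟨φ, ψ, -, -, -, -, h5, h6, h7⟩ := h
  exact ⟨φ, h5, by simp [Diagram.leg, ← reassoc_of% h6, h7]⟩

section

variable [AdmitsConjugation I A]

lemma rel_of_span {a b : U} {d e : Diagram I A a b} (φ : d.src ≅ e.src)
    (h1 : φ.hom ≫ e.coker = d.coker) (h2 : φ.hom ≫ e.leg = d.leg) : Rel d e := by
  have hφ : I φ.hom := mem_of_comp A _ _ e.coker_mem (h1 ▸ d.coker_mem)
  have hφ' : I φ.inv := mem_of_comp A _ d.coker d.coker_mem (by
    rw [← h1]; simpa using e.coker_mem)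
  obtain ⟨ψ, k1, k2, k3, k4⟩ := AdmitsConjugation.exists_lift (I := I) (A := A)
    (φ.hom ≫ e.mid) e.im d.mid d.im
    (A.comp_mem _ _ (AdmitsConjugation.iso_mem (I := I) φ hφ hφ').1 e.mid_mem) e.im_mem
    d.mid_mem d.im_mem (by simpa [leg] using h2)
  exact ⟨φ, ψ, hφ, hφ', k1, k2, h1, k3, k4⟩

lemma CompData.isSpanComp {a b c : U} {d : Diagram I A a b} {e : Diagram I A b c}
    (X : CompData d e) : IsSpanComp d e X.composite := by
  refine ⟨X.k'', X.α' ≫ X.j'.hom, ?_, rfl, ?_⟩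
  · exact (X.isPullback'.flip.paste_horiz (isPullback_of_indexing A X.isPullback).flip).flip
  · have := X.fac
    simp only [leg, CompData.composite, Category.assoc]
    rw [reassoc_of% this]

lemma exists_compData {a b c : U} (d : Diagram I A a b) (e : Diagram I A b c) :
    Nonempty (CompData d e) := by
  have := (AdmitsConjugation.indexing (I := I) (A := A)).hasPullbacks
  let j := wideHom d.im d.im_mem
  let k := wideHom e.coker e.coker_mem
  obtain ⟨p, k'', α', h1, h2, h3⟩ := AdmitsConjugation.exists_pullback (I := I) (A := A)
    d.mid (pullback.fst j k).hom d.mid_mem (pullback.fst j k).property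
  obtain ⟨r, γ', j'', h4, h5, h6⟩ := AdmitsConjugation.exists_fac (I := I) (A := A)
    ((pullback.snd j k).hom ≫ e.mid)
  exact ⟨{ q := _, k' := _, j' := _, isPullback := IsPullback.of_hasPullback j k, p := p,
           k'' := k'', α' := α', k''_mem := h1, α'_mem := h2, isPullback' := h3, r := r,
           γ' := γ', j'' := j'', γ'_mem := h4, j''_mem := h5, fac := h6 }⟩

/-- The composite of two diagrams, well defined up to equivalence. -/
noncomputable def comp {a b c : U} (d : Diagram I A a b) (e : Diagram I A b c) :
    Diagram I A a c :=
  (exists_compData d e).some.composite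

lemma comp_isSpanComp {a b c : U} (d : Diagram I A a b) (e : Diagram I A b c) :
    IsSpanComp d e (comp d e) :=
  CompData.isSpanComp _

lemma IsSpanComp.unique {a b c : U} {d : Diagram I A a b} {e : Diagram I A b c}
    {x y : Diagram I A a c} (hx : IsSpanComp d e x) (hy : IsSpanComp d e y) : Rel x y := by
  obtain ⟨f, g, h, h1, h2⟩ := hx
  obtain ⟨f', g', h', h1', h2'⟩ := hy
  refine rel_of_span (h.isoIsPullback _ _ h') ?_ ?_
  · rw [← h1, ← h1']; simp
  · rw [← h2, ← h2']; simp

lemma IsSpanComp.congr {a b c : U} {d d' : Diagram I A a b} {e e' : Diagram I A b c}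
    {x : Diagram I A a c} (hx : IsSpanComp d e x) (hd : Rel d d') (he : Rel e e') :
    IsSpanComp d' e' x := by
  obtain ⟨f, g, h, h1, h2⟩ := hx
  obtain ⟨φ, p1, p2⟩ := hd.leg
  obtain ⟨ψ, q1, q2⟩ := he.leg
  refine ⟨f ≫ φ.hom, g ≫ ψ.hom, ?_, by simp [p1, h1], by simp [q2, h2]⟩
  exact h.of_iso (Iso.refl _) φ ψ (Iso.refl _) (by simp) (by simp) (by simp [p2]) (by simp [q1])

lemma comp_congr {a b c : U} {d d' : Diagram I A a b} {e e' : Diagram I A b c}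
    (hd : Rel d d') (he : Rel e e') : Rel (comp d e) (comp d' e') :=
  ((comp_isSpanComp d e).congr hd he).unique (comp_isSpanComp d' e')

lemma comp_assoc {a b c z : U} (d : Diagram I A a b) (e : Diagram I A b c)
    (f : Diagram I A c z) : Rel (comp (comp d e) f) (comp d (comp e f)) := by
  obtain ⟨p1, p2, hp, hp1, hp2⟩ := comp_isSpanComp d e
  obtain ⟨q1, q2, hq, hq1, hq2⟩ := comp_isSpanComp (comp d e) f
  obtain ⟨r1, r2, hr, hr1, hr2⟩ := comp_isSpanComp e f
  refine IsSpanComp.unique (d := d) (e := comp e f) ?_ (comp_isSpanComp _ _)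
  have hw : (q1 ≫ p2) ≫ e.leg = q2 ≫ f.coker := by rw [Category.assoc, hp2, hq.w]
  have e1 : hr.lift (q1 ≫ p2) q2 hw ≫ r1 = q1 ≫ p2 := hr.lift_fst _ _ _
  have e2 : hr.lift (q1 ≫ p2) q2 hw ≫ r2 = q2 := hr.lift_snd _ _ _
  refine ⟨q1 ≫ p1, hr.lift (q1 ≫ p2) q2 hw, ?_, ?_, ?_⟩
  · have h1 : IsPullback q1 (hr.lift (q1 ≫ p2) q2 hw) p2 r1 := by
      refine (IsPullback.of_right (h₁₂ := r2) (h₂₂ := e.leg) (v₁₃ := f.coker) ?_ e1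
        hr.flip).flip
      rw [e2, hp2]
      exact hq.flip
    rw [← hr1]
    exact h1.paste_horiz hp
  · rw [Category.assoc, hp1, hq1]
  · rw [← hr2, ← hq2, reassoc_of% e2]

lemma id_comp {a b : U} (d : Diagram I A a b) : Rel (comp (id I A a) d) d := by
  refine (comp_isSpanComp _ _).unique ⟨d.coker, 𝟙 _, ?_, ?_, ?_⟩
  · change IsPullback d.coker (𝟙 d.src) (𝟙 a ≫ 𝟙 a) d.coker
    rw [Category.comp_id]
    exact IsPullback.of_vert_isIso ⟨by simp⟩
  · exact Category.comp_id _
  · exact Category.id_comp _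

lemma comp_id {a b : U} (d : Diagram I A a b) : Rel (comp d (id I A b)) d := by
  refine (comp_isSpanComp _ _).unique ⟨𝟙 _, d.leg, ?_, ?_, ?_⟩
  · change IsPullback (𝟙 d.src) d.leg d.leg (𝟙 b)
    exact IsPullback.of_horiz_isIso ⟨by simp⟩
  · exact Category.id_comp _
  · change d.leg ≫ 𝟙 b ≫ 𝟙 b = d.leg
    simp

end

end Diagram

/-- The objects of the category `B = I ∘ A ∘ Iᵒᵖ` are those of `U`. -/
@[ext]
structure ThreeFold {U : Type w} [SmallCategory.{w} U] (_I _A : MorphismProperty U) where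
  obj : U

/-- The category `B = I ∘ A ∘ Iᵒᵖ`: morphisms are classes of diagrams. -/
noncomputable instance [AdmitsConjugation I A] : SmallCategory.{w} (ThreeFold I A) where
  Hom a b := Quotient (Diagram.setoid I A a.obj b.obj)
  id a := Quotient.mk _ (Diagram.id I A a.obj)
  comp {a b c} := Quotient.map₂ Diagram.comp
    (fun d d' h e e' h' => show Diagram.Rel _ _ from Diagram.comp_congr h h')
  id_comp := by
    rintro a b ⟨d⟩
    exact Quotient.sound (Diagram.id_comp d)
  comp_id := by
    rintro a b ⟨d⟩
    exact Quotient.sound (Diagram.comp_id d)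
  assoc := by
    rintro a b c z ⟨d⟩ ⟨e⟩ ⟨f⟩
    exact Quotient.sound (Diagram.comp_assoc d e f)

/-! ### Regular maps and the regular bimodule -/

/-- The inclusion of `A` in `B`. -/
noncomputable def inclusion (I A : MorphismProperty U) [I.IsMultiplicative] [A.IsMultiplicative]
    [AdmitsConjugation I A] : WideSubcategory A ⥤ ThreeFold I A where
  obj a := ⟨a.obj⟩
  map {a b} α := Quotient.mk _ (Diagram.ofFac I A b.obj α.hom (𝟙 b.obj) α.property (I.id_mem _))
  map_id a := rfl
  map_comp {a b c} α β := by
    refine Quotient.sound (Diagram.IsSpanComp.unique ?_ (Diagram.comp_isSpanComp _ _))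
    refine ⟨𝟙 a.obj, α.hom, ?_, ?_, ?_⟩
    · change IsPullback (𝟙 a.obj) α.hom (α.hom ≫ 𝟙 b.obj) (𝟙 b.obj)
      exact IsPullback.of_horiz_isIso ⟨by simp⟩
    · exact Category.comp_id _
    · change α.hom ≫ β.hom ≫ 𝟙 _ = (α.hom ≫ β.hom) ≫ 𝟙 _
      simp

section Regular

variable [AdmitsConjugation I A]

/-- The regular maps of `B` are those lying in the subcategory `U = I ∘ A`, i.e. those of the
form `q ∘ p ∘ 1*` with `p` in `A` and `q` in `I`. The other maps are singular. -/
def IsRegular {a b : ThreeFold I A} (f : a ⟶ b) : Prop :=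
  ∃ (c : U) (p : a.obj ⟶ c) (q : c ⟶ b.obj) (hp : A p) (hq : I q),
    f = Quotient.mk (Diagram.setoid I A a.obj b.obj) (Diagram.ofFac I A c p q hp hq)

lemma inv_mem (A : MorphismProperty U) [A.IsMultiplicative] [AdmitsConjugation I A]
    {a b : U} (i : a ⟶ b) [IsIso i] (hi : I i) : I (inv i) :=
  mem_of_comp A _ i hi (by simpa using I.id_mem b)

lemma isRegular_mk_iff {a b : ThreeFold I A} (d : Diagram I A a.obj b.obj) :
    IsRegular (a := a) (b := b) (Quotient.mk _ d) ↔ IsIso d.coker := by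
  constructor
  · rintro ⟨c, p, q, hp, hq, h⟩
    obtain ⟨φ, -, -, -, -, -, h5, -, -⟩ := (Quotient.exact h : Diagram.Rel _ _)
    have h6 : φ.hom ≫ 𝟙 a.obj = d.coker := h5
    rw [← h6]
    change IsIso (φ.hom ≫ 𝟙 (Diagram.ofFac I A c p q hp hq).src)
    infer_instance
  · intro h
    have h1 := inv_mem A d.coker d.coker_mem
    have h2 := (AdmitsConjugation.iso_mem (I := I) (A := A) (asIso d.coker) d.coker_mem
      (by simpa using h1)).2
    refine ⟨d.tgt, inv d.coker ≫ d.mid, d.im, A.comp_mem _ _ (by simpa using h2) d.mid_mem,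
      d.im_mem, Quotient.sound ?_⟩
    refine Diagram.rel_of_span (e := Diagram.ofFac I A d.tgt (inv d.coker ≫ d.mid) d.im _ _)
      (@asIso U _ d.src a.obj d.coker h) ?_ ?_
    · exact Category.comp_id _
    · change d.coker ≫ (inv d.coker ≫ d.mid) ≫ d.im = d.mid ≫ d.im
      simp

/-- If `g ∘ f` is regular then so is `f`. -/
lemma IsRegular.of_comp {a b c : ThreeFold I A} {f : a ⟶ b} {g : b ⟶ c}
    (h : IsRegular (f ≫ g)) : IsRegular f := by
  obtain ⟨d, rfl⟩ := Quotient.exists_rep f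
  obtain ⟨e, rfl⟩ := Quotient.exists_rep g
  have h' : IsRegular (a := a) (b := c) (Quotient.mk _ (Diagram.comp d e)) := h
  rw [isRegular_mk_iff] at h' ⊢
  obtain ⟨k, l, -, h1, -⟩ := Diagram.comp_isSpanComp d e
  have : IsIso (k ≫ d.coker) := by rw [h1]; exact h'
  refine ⟨inv (k ≫ d.coker) ≫ k, ?_, by simp⟩
  exact cancel_index (I := I) A _ _ d.coker d.coker_mem (by simp)

lemma isIso_of_isPullback (I A : MorphismProperty U) [I.IsMultiplicative] [A.IsMultiplicative]
    [AdmitsConjugation I A] {a b s x : U} {α : a ⟶ b} (hα : A α) {i : s ⟶ b} (hi : I i)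
    {k : x ⟶ a} {l : x ⟶ s} (h : IsPullback k l α i) [IsIso k] : IsIso i := by
  obtain ⟨p, i', α', hi', hα', hp⟩ := AdmitsConjugation.exists_pullback (I := I) (A := A) α i hα hi
  have e : i' = (hp.isoIsPullback _ _ h).hom ≫ k := by simp
  have : IsIso i' := by rw [e]; infer_instance
  have h3 := (AdmitsConjugation.iso_mem (I := I) (A := A) (asIso i') hi'
    (by simpa using inv_mem A i' hi')).2
  obtain ⟨φ, -, -, -, h4⟩ := AdmitsConjugation.exists_lift (I := I) (A := A)
    α (𝟙 b) (inv i' ≫ α') i hα (I.id_mem _)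
    (A.comp_mem _ _ (by simpa using h3) hα') hi (by simp [← hp.w])
  have h5 : φ.hom = i := by simpa using h4
  rw [← h5]
  infer_instance

/-- If `g ∘ α` is regular with `α` in `A` then so is `g`. -/
lemma IsRegular.of_inclusion_comp {a b : WideSubcategory A} {c : ThreeFold I A} {α : a ⟶ b}
    {g : (inclusion I A).obj b ⟶ c} (h : IsRegular ((inclusion I A).map α ≫ g)) :
    IsRegular g := by
  obtain ⟨e, rfl⟩ := Quotient.exists_rep g
  let d := Diagram.ofFac I A b.obj α.hom (𝟙 b.obj) α.property (I.id_mem _)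
  have h' : IsRegular (a := (inclusion I A).obj a) (b := c)
    (Quotient.mk _ (Diagram.comp d e)) := h
  rw [isRegular_mk_iff] at h' ⊢
  obtain ⟨k, l, hkl, h1, -⟩ := Diagram.comp_isSpanComp d e
  have h2 : (Diagram.comp d e).coker = k := h1.symm.trans (Category.comp_id _)
  have hk : IsIso k := h2 ▸ h'
  exact isIso_of_isPullback I A (A.comp_mem _ _ d.mid_mem (A.id_mem _)) e.coker_mem hkl

open Classical in
/-- The map of based sets `U(b, c)₊ ⟶ U(a, d)₊`, `γ ↦ β ∘ γ ∘ α`, for `α : a ⟶ b` in `A` and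
`β : c ⟶ d` in `B`; here `U(b, c)₊ = B(b, c) / {singular maps}` is the set of regular maps with a
disjoint basepoint `none`, which stands for all singular maps. -/
noncomputable def regularMap {a b : WideSubcategory A} {c d : ThreeFold I A} (α : a ⟶ b)
    (β : c ⟶ d) :
    Option {γ : (inclusion I A).obj b ⟶ c // IsRegular γ} →
      Option {γ : (inclusion I A).obj a ⟶ d // IsRegular γ}
  | none => none
  | some γ =>
    if h : IsRegular ((inclusion I A).map α ≫ γ.1 ≫ β) then some ⟨_, h⟩ else none

lemma regularMap_id (a : WideSubcategory A) (c : ThreeFold I A)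
    (x : Option {γ : (inclusion I A).obj a ⟶ c // IsRegular γ}) :
    regularMap (𝟙 a) (𝟙 c) x = x := by
  cases x with
  | none => rfl
  | some γ =>
    have e : (inclusion I A).map (𝟙 a) ≫ γ.1 ≫ 𝟙 c = γ.1 := by simp
    simp only [regularMap]
    rw [dif_pos (by rw [e]; exact γ.2)]
    exact congrArg some (Subtype.ext e)

lemma regularMap_comp {a a' a'' : WideSubcategory A} {c c' c'' : ThreeFold I A} (α : a' ⟶ a)
    (α' : a'' ⟶ a') (β : c ⟶ c') (β' : c' ⟶ c'')
    (x : Option {γ : (inclusion I A).obj a ⟶ c // IsRegular γ}) :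
    regularMap α' β' (regularMap α β x) = regularMap (α' ≫ α) (β ≫ β') x := by
  cases x with
  | none => rfl
  | some γ =>
    have e : (inclusion I A).map (α' ≫ α) ≫ γ.1 ≫ β ≫ β' =
        (inclusion I A).map α' ≫ ((inclusion I A).map α ≫ γ.1 ≫ β) ≫ β' := by simp
    by_cases h : IsRegular ((inclusion I A).map α ≫ γ.1 ≫ β)
    · by_cases h' : IsRegular ((inclusion I A).map α' ≫ ((inclusion I A).map α ≫ γ.1 ≫ β) ≫ β')
      · have h'' := h'
        rw [← e] at h''
        simp only [regularMap, dif_pos h, dif_pos h', dif_pos h'']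
        exact congrArg some (Subtype.ext e.symm)
      · have h'' := h'
        rw [← e] at h''
        simp only [regularMap, dif_pos h, dif_neg h', dif_neg h'']
    · have h' : ¬ IsRegular ((inclusion I A).map (α' ≫ α) ≫ γ.1 ≫ β ≫ β') := by
        rw [e]
        exact fun k => h (IsRegular.of_comp (IsRegular.of_inclusion_comp k))
      simp only [regularMap, dif_neg h, dif_neg h']

end Regular

/-- The regular bimodule `U₊ : Aᵒᵖ × B ⟶ Sets_*`. -/
noncomputable def regularBimodule (I A : MorphismProperty U) [I.IsMultiplicative]
    [A.IsMultiplicative] [AdmitsConjugation I A] :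
    (WideSubcategory A)ᵒᵖ ⥤ ThreeFold I A ⥤ Pointed.{w} where
  obj a :=
    { obj := fun b =>
        ⟨Option {γ : (inclusion I A).obj a.unop ⟶ b // IsRegular γ}, none⟩
      map := fun β => ⟨regularMap (𝟙 a.unop) β, rfl⟩
      map_id := fun b => Pointed.Hom.ext (funext fun x => regularMap_id _ _ x)
      map_comp := fun β β' => Pointed.Hom.ext (funext fun x => by
        simpa using (regularMap_comp (𝟙 a.unop) (𝟙 a.unop) β β' x).symm) }
  map {a a'} α :=
    { app := fun b => ⟨regularMap α.unop (𝟙 b), rfl⟩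
      naturality := fun b b' β => Pointed.Hom.ext (funext fun x => by
        simpa using (regularMap_comp (𝟙 a.unop) α.unop β (𝟙 b') x).trans (by
          simpa using (regularMap_comp α.unop (𝟙 a'.unop) (𝟙 b) β x).symm)) }
  map_id a := by
    refine NatTrans.ext (funext fun b => ?_)
    exact Pointed.Hom.ext (funext fun x => regularMap_id _ _ x)
  map_comp α α' := by
    refine NatTrans.ext (funext fun b => ?_)
    exact Pointed.Hom.ext (funext fun x => by
      simpa using (regularMap_comp α.unop α'.unop (𝟙 b) (𝟙 b) x).symm)

/-! ### The right adjoint associated to a bimodule -/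

section RightAdjoint

variable {C : Type u} [Category.{v} C] [HasZeroMorphisms C] [HasProducts.{v} C]

/-- The map `∏_T X ⟶ ∏_S Y` induced by a map `X ⟶ Y` and a map `S ⟶ T` of based sets. Products
indexed by a based set have one factor for each element different from the basepoint, the factor
at the basepoint being zero. -/
noncomputable def basedPowerMap {S T : Pointed.{v}} {X Y : C} (f : X ⟶ Y) (φ : S ⟶ T) :
    (∏ᶜ fun _ : {t : T.X // t ≠ T.point} => X) ⟶ ∏ᶜ fun _ : {s : S.X // s ≠ S.point} => Y :=
  open Classical in
  Pi.lift fun s => if h : φ.toFun s.1 = T.point then 0 else Pi.π _ ⟨φ.toFun s.1, h⟩ ≫ f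

lemma basedPowerMap_π_of_eq {S T : Pointed.{v}} {X Y : C} (f : X ⟶ Y) (φ : S ⟶ T)
    (s : {s : S.X // s ≠ S.point}) (h : φ.toFun s.1 = T.point) :
    basedPowerMap f φ ≫ Pi.π _ s = 0 := by
  simp [basedPowerMap, dif_pos h]

lemma basedPowerMap_π_of_ne {S T : Pointed.{v}} {X Y : C} (f : X ⟶ Y) (φ : S ⟶ T)
    (s : {s : S.X // s ≠ S.point}) (h : φ.toFun s.1 ≠ T.point) :
    basedPowerMap f φ ≫ Pi.π _ s = Pi.π _ ⟨φ.toFun s.1, h⟩ ≫ f := by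
  simp [basedPowerMap, dif_neg h]

lemma basedPowerMap_id (S : Pointed.{v}) (X : C) : basedPowerMap (𝟙 X) (𝟙 S) = 𝟙 _ := by
  refine Pi.hom_ext _ _ fun s => ?_
  have : (𝟙 S : S ⟶ S).toFun s.1 ≠ S.point := s.2
  rw [basedPowerMap_π_of_ne _ _ _ this, Category.comp_id, Category.id_comp]
  rfl

lemma basedPowerMap_comp {S T V : Pointed.{v}} {X Y Z : C} (f : X ⟶ Y) (g : Y ⟶ Z) (φ : S ⟶ T)
    (ψ : T ⟶ V) :
    basedPowerMap f ψ ≫ basedPowerMap g φ = basedPowerMap (f ≫ g) (φ ≫ ψ) := by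
  refine Pi.hom_ext _ _ fun s => ?_
  rw [Category.assoc]
  by_cases h : φ.toFun s.1 = T.point
  · have h' : (φ ≫ ψ).toFun s.1 = V.point := by
      rw [Pointed.Hom.comp_toFun', Function.comp_apply, h, ψ.map_point]
    rw [basedPowerMap_π_of_eq _ _ _ h, basedPowerMap_π_of_eq _ _ _ h', comp_zero]
  · rw [basedPowerMap_π_of_ne _ _ _ h, ← Category.assoc]
    by_cases h' : ψ.toFun (φ.toFun s.1) = V.point
    · rw [basedPowerMap_π_of_eq f ψ ⟨_, h⟩ h', basedPowerMap_π_of_eq (f ≫ g) (φ ≫ ψ) s h',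
        zero_comp]
    · rw [basedPowerMap_π_of_ne f ψ ⟨_, h⟩ h', basedPowerMap_π_of_ne (f ≫ g) (φ ≫ ψ) s h',
        Category.assoc]
      rfl

variable (C) in
/-- The functor `(X, S) ↦ ∏_S X`. -/
noncomputable def basedPower : C ⥤ Pointed.{v}ᵒᵖ ⥤ C where
  obj X :=
    { obj := fun S => ∏ᶜ fun _ : {s : S.unop.X // s ≠ S.unop.point} => X
      map := fun φ => basedPowerMap (𝟙 X) φ.unop
      map_id := fun S => basedPowerMap_id S.unop X
      map_comp := fun φ ψ => by simp [basedPowerMap_comp] }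
  map f :=
    { app := fun S => basedPowerMap f (𝟙 S.unop)
      naturality := fun S T φ => by simp [basedPowerMap_comp] }
  map_id X := by
    ext S : 2
    exact basedPowerMap_id S.unop X
  map_comp f g := by
    ext S : 2
    simp [basedPowerMap_comp]

variable {D : Type v} [SmallCategory.{v} D] {E : Type v} [SmallCategory.{v} E]

/-- For `P : Dᵒᵖ ⥤ Sets_*`, the functor sending `G : Dᵒᵖ ⥤ C` to the functor
`(x, y) ↦ ∏_{P(y)} G(x)` on `Dᵒᵖ × D`. -/
noncomputable def powerBifunctor (P : Dᵒᵖ ⥤ Pointed.{v}) : (Dᵒᵖ ⥤ C) ⥤ Dᵒᵖ ⥤ D ⥤ C :=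
  (Functor.whiskeringRight _ _ _).obj
    (basedPower C ⋙ (Functor.whiskeringLeft _ _ _).obj P.rightOp)

/-- Functoriality of `powerBifunctor` in `P`. -/
noncomputable def powerBifunctorMap {P P' : Dᵒᵖ ⥤ Pointed.{v}} (σ : P ⟶ P') (G : Dᵒᵖ ⥤ C) :
    (powerBifunctor P').obj G ⟶ (powerBifunctor P).obj G where
  app x :=
    { app := fun y => ((basedPower C).obj (G.obj x)).map (σ.app (op y)).op
      naturality := fun y y' g => by
        simp only [powerBifunctor, Functor.whiskeringRight_obj_obj, Functor.comp_obj,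
          Functor.comp_map, Functor.whiskeringLeft_obj_obj, Functor.rightOp_map,
          ← Functor.map_comp, ← op_comp, σ.naturality] }
  naturality x x' g := by
    ext y
    exact (((basedPower C).map (G.map g)).naturality (σ.app (op y)).op).symm

lemma powerBifunctorMap_id (P : Dᵒᵖ ⥤ Pointed.{v}) (G : Dᵒᵖ ⥤ C) :
    powerBifunctorMap (𝟙 P) G = 𝟙 _ := by
  refine NatTrans.ext (funext fun x => NatTrans.ext (funext fun y => ?_))
  exact ((basedPower C).obj (G.obj x)).map_id _

lemma powerBifunctorMap_comp {P P' P'' : Dᵒᵖ ⥤ Pointed.{v}} (σ : P ⟶ P') (σ' : P' ⟶ P'')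
    (G : Dᵒᵖ ⥤ C) :
    powerBifunctorMap σ' G ≫ powerBifunctorMap σ G = powerBifunctorMap (σ ≫ σ') G := by
  refine NatTrans.ext (funext fun x => NatTrans.ext (funext fun y => ?_))
  exact (((basedPower C).obj (G.obj x)).map_comp _ _).symm

lemma powerBifunctorMap_naturality {P P' : Dᵒᵖ ⥤ Pointed.{v}} (σ : P ⟶ P') {G G' : Dᵒᵖ ⥤ C}
    (τ : G ⟶ G') :
    (powerBifunctor P').map τ ≫ powerBifunctorMap σ G' =
      powerBifunctorMap σ G ≫ (powerBifunctor P).map τ := by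
  refine NatTrans.ext (funext fun x => NatTrans.ext (funext fun y => ?_))
  exact (((basedPower C).map (τ.app x)).naturality (σ.app (op y)).op).symm

variable [HasLimits C]

/-- `Hom^D(P, G)`, the end of `(x, y) ↦ ∏_{P(y)} G(x)`. -/
noncomputable def homEnd (P : Dᵒᵖ ⥤ Pointed.{v}) (G : Dᵒᵖ ⥤ C) : C :=
  end_ ((powerBifunctor P).obj G)

/-- The functor `R` associated to a bimodule `P : Dᵒᵖ × E ⟶ Sets_*`: it sends `G : Dᵒᵖ ⥤ C` to
`b ↦ Hom^D(P(-, b), G)`. -/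
noncomputable def bimoduleRight (P : Dᵒᵖ ⥤ E ⥤ Pointed.{v}) : (Dᵒᵖ ⥤ C) ⥤ Eᵒᵖ ⥤ C where
  obj G :=
    { obj := fun b => homEnd (P.flip.obj b.unop) G
      map := fun β => end_.map (powerBifunctorMap (P.flip.map β.unop) G)
      map_id := fun b => by
        rw [unop_id, P.flip.map_id, powerBifunctorMap_id]
        exact end_.map_id
      map_comp := fun β β' => by
        rw [unop_comp, P.flip.map_comp, ← powerBifunctorMap_comp]
        exact (end_.map_comp _ _).symm }
  map τ :=
    { app := fun b => end_.map ((powerBifunctor (P.flip.obj b.unop)).map τ)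
      naturality := fun b b' β =>
        (end_.map_comp _ _).trans (((congrArg end_.map
          (powerBifunctorMap_naturality (P.flip.map β.unop) τ)).symm).trans
            (end_.map_comp _ _).symm) }
  map_id G := by
    refine NatTrans.ext (funext fun b => ?_)
    exact (congrArg end_.map ((powerBifunctor _).map_id G)).trans end_.map_id
  map_comp τ τ' := by
    refine NatTrans.ext (funext fun b => ?_)
    exact (congrArg end_.map ((powerBifunctor _).map_comp τ τ')).trans (end_.map_comp _ _).symm

end RightAdjoint

/-- The functor `R : [Aᵒᵖ, C] ⥤ [Bᵒᵖ, C]` of a conjugate pair `(B, A)`, where `B` is equivalent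
to `I ∘ A ∘ Iᵒᵖ`: the right adjoint associated to the regular bimodule. -/
noncomputable def conjugateRight (C : Type u) [Category.{v} C] [HasZeroMorphisms C] [HasLimits C]
    {U : Type v} [SmallCategory.{v} U] (I A : MorphismProperty U) [I.IsMultiplicative]
    [A.IsMultiplicative] [AdmitsConjugation I A] {B : Type v} [SmallCategory.{v} B]
    (e : B ≌ ThreeFold I A) : ((WideSubcategory A)ᵒᵖ ⥤ C) ⥤ Bᵒᵖ ⥤ C :=
  bimoduleRight (regularBimodule I A ⋙ (Functor.whiskeringLeft _ _ _).obj e.functor)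

end ConjugatePairs

/-! ### The projective model structure on functor categories -/

namespace Projective

variable {D : Type v} [SmallCategory.{v} D] {C : Type u} [Category.{v} C] [ModelCategory C]

/-- Weak equivalences of diagrams are objectwise. -/
instance : CategoryWithWeakEquivalences (D ⥤ C) where
  weakEquivalences := (weakEquivalences C).functorCategory D

/-- Fibrations of diagrams are objectwise. -/
instance : CategoryWithFibrations (D ⥤ C) where
  fibrations := (fibrations C).functorCategory D

/-- Cofibrations of diagrams are the maps with the left lifting property with respect to the
objectwise acyclic fibrations. -/
instance : CategoryWithCofibrations (D ⥤ C) where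
  cofibrations := (trivialFibrations (D ⥤ C)).llp

end Projective

/-! ### Semi-stable model categories -/

namespace SemiStable

section

variable (C : Type u) [Category.{v} C] [ModelCategory C] [HasLimits C] [HasColimits C]
  [HasZeroObject C] [HasZeroMorphisms C]

/-- The model category `C` is cofibrantly generated. -/
def IsCofibrantlyGenerated : Prop :=
  ∃ I J : MorphismProperty C, I.HasSmallObjectArgument.{v} ∧ J.HasSmallObjectArgument.{v} ∧
    fibrations C = J.rlp ∧ trivialFibrations C = I.rlp

/-- The model category `C` is left and right proper. -/
structure IsProper : Prop where
  left : ∀ {X Y Z P : C} (f : X ⟶ Y) (i : X ⟶ Z) (j : Y ⟶ P) (g : Z ⟶ P), IsPushout f i j g →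
    WeakEquivalence f → Cofibration i → WeakEquivalence g
  right : ∀ {P X Y Z : C} (g : P ⟶ X) (q : P ⟶ Y) (p : X ⟶ Z) (f : Y ⟶ Z), IsPullback g q p f →
    WeakEquivalence f → Fibration p → WeakEquivalence g

/-- The standing assumptions on the pointed model category `C`. -/
structure StandingAssumptions : Prop where
  cofibrantlyGenerated : IsCofibrantlyGenerated C
  proper : IsProper C
  fibration_fst : ∀ X Y : C, Fibration (prod.fst : X ⨯ Y ⟶ X)
  fibration_snd : ∀ X Y : C, Fibration (prod.snd : X ⨯ Y ⟶ Y)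
  prod_acyclicFibrations : ∀ {X Y X' Y' : C} (f : X ⟶ Y) (g : X' ⟶ Y'),
    Fibration f → WeakEquivalence f → Fibration g → WeakEquivalence g →
      WeakEquivalence (prod.map f g)
  coprod_acyclicCofibrations : ∀ {X Y X' Y' : C} (f : X ⟶ Y) (g : X' ⟶ Y'),
    Cofibration f → WeakEquivalence f → Cofibration g → WeakEquivalence g →
      WeakEquivalence (coprod.map f g)

variable {C}

/-- A commutative square with `X ⟶ Y` and `X ⟶ Z` is a homotopy pushout if, after factoring these
two maps as cofibrations `X ⟶ Y'` and `X ⟶ Z'` followed by acyclic fibrations, the induced map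
from the pushout of `Y'` and `Z'` to `P` is a weak equivalence. In a proper model category this
does not depend on the factorizations. -/
def IsHomotopyPushout {X Y Z P : C} (f : X ⟶ Y) (g : X ⟶ Z) (h : Y ⟶ P) (k : Z ⟶ P) : Prop :=
  ∃ w : f ≫ h = g ≫ k,
    ∀ (F : MorphismProperty.MapFactorizationData (cofibrations C) (trivialFibrations C) f)
      (G : MorphismProperty.MapFactorizationData (cofibrations C) (trivialFibrations C) g),
      WeakEquivalence (pushout.desc (F.p ≫ h) (G.p ≫ k)
        (by rw [F.fac_assoc, G.fac_assoc, w]) : pushout F.i G.i ⟶ P)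

/-- A cofibrant replacement of a diagram, for the projective model structure. -/
structure CofibrantReplacement {D : Type v} [SmallCategory.{v} D] (X : D ⥤ C) where
  obj : D ⥤ C
  hom : obj ⟶ X
  cofibrant : IsCofibrant obj
  fibration : Fibration hom
  weakEquivalence : WeakEquivalence hom

variable (C)

/-- Let `A₁`, `A₂` be cofibrant and let `f : A₁ ∨ A₂ ⟶ A₁ × A₂` have components
`f_ij : A_i ⟶ A_j`. If `f₁₁` and `f₂₂` are weak equivalences and `f₁₂ = 0`, then `f` is a weak
equivalence. -/
def LowerTriangularAxiom : Prop :=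
  ∀ {A₁ A₂ : C} (f : A₁ ⨿ A₂ ⟶ A₁ ⨯ A₂), IsCofibrant A₁ → IsCofibrant A₂ →
    WeakEquivalence (coprod.inl ≫ f ≫ prod.fst) →
    WeakEquivalence (coprod.inr ≫ f ≫ prod.snd) →
    coprod.inl ≫ f ≫ prod.snd = 0 → WeakEquivalence f

/-- The product of two homotopy pushout squares is a homotopy pushout square. -/
def PushoutProductCoherence : Prop :=
  ∀ {X₁ Y₁ Z₁ P₁ X₂ Y₂ Z₂ P₂ : C}
    (f₁ : X₁ ⟶ Y₁) (g₁ : X₁ ⟶ Z₁) (h₁ : Y₁ ⟶ P₁) (k₁ : Z₁ ⟶ P₁)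
    (f₂ : X₂ ⟶ Y₂) (g₂ : X₂ ⟶ Z₂) (h₂ : Y₂ ⟶ P₂) (k₂ : Z₂ ⟶ P₂),
    IsHomotopyPushout f₁ g₁ h₁ k₁ → IsHomotopyPushout f₂ g₂ h₂ k₂ →
      IsHomotopyPushout (prod.map f₁ f₂) (prod.map g₁ g₂) (prod.map h₁ h₂) (prod.map k₁ k₂)

/-- For an ordinal `o` and cofibrant `o`-sequences `X` and `Y`, the natural map
`hocolim (X × Y) ⟶ hocolim X × hocolim Y` is an isomorphism in the homotopy category. Here
`hocolim` is the colimit of a cofibrant replacement `Q`, and the natural map is induced by lifts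
`Q(X × Y) ⟶ QX` and `Q(X × Y) ⟶ QY` of the two projections. -/
def ColimitProductCoherence : Prop :=
  ∀ (o : Ordinal.{v}) (X Y : o.ToType ⥤ C), IsCofibrant X → IsCofibrant Y →
    ∀ (QX : CofibrantReplacement X) (QY : CofibrantReplacement Y)
      (QXY : CofibrantReplacement (X ⨯ Y)) (l₁ : QXY.obj ⟶ QX.obj) (l₂ : QXY.obj ⟶ QY.obj),
      l₁ ≫ QX.hom = QXY.hom ≫ prod.fst → l₂ ≫ QY.hom = QXY.hom ≫ prod.snd →
      IsIso ((weakEquivalences C).Q.map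
        (prod.lift (colimMap l₁) (colimMap l₂) :
          colimit QXY.obj ⟶ colimit QX.obj ⨯ colimit QY.obj))

/-- `C` is a semi-stable model category: it satisfies the standing assumptions and the three
product-coproduct coherence axioms. -/
class IsSemiStable : Prop where
  standing : StandingAssumptions C
  lowerTriangular : LowerTriangularAxiom C
  pushoutProduct : PushoutProductCoherence C
  colimitProduct : ColimitProductCoherence C

end

end SemiStable

/-! Evaluated at one object, `R` is just a product of values. Every map of `U` into `b` factors as a
map of `A` followed by a map of `I`. Once representatives of the isomorphism classes of `I ↓ b` are
fixed, the factorization through a representative is unique: condition (1) determines the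
representative, and maps of `I` are monomorphisms of `U`. Hence the presheaf `x ↦ U(x, b)` on `A` is
a disjoint union of representables, one for each class of maps `s ⟶ b` in `I`, and by Yoneda the end
`RG(b)` is the product of the values `G(s)` (`isIso_homEndToPi`), naturally in `G`
(`homEndToPi_naturality`). So `Rτ` at `b` is the product of the components of `τ` at these sources.

Every object of a semi-stable category is fibrant, so by Ken Brown's argument a product of weak
equivalences is a weak equivalence (`weakEquivalence_piMap`). Conversely, in a pointed category each
factor is a retract of the product (`weakEquivalence_of_piMap`), and the identity of `a` is a map of
`I`, so `τ` at `a` is, up to isomorphism, a factor of `Rτ` at `a`. -/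

namespace HomotopicalAlgebra

/-! ### Products of weak equivalences, and fibrancy of all objects -/

variable {C : Type u} [Category.{v} C] [ModelCategory C]

/-- Arbitrary products of weak equivalences between fibrant objects are weak equivalences. -/
lemma weakEquivalence_piMap {S : Type w} [HasProductsOfShape S C] {X Y : S → C}
    (f : ∀ s, X s ⟶ Y s) [∀ s, IsFibrant (X s)] [∀ s, IsFibrant (Y s)]
    [∀ s, WeakEquivalence (f s)] : WeakEquivalence (Limits.Pi.map f) := by
  -- Ken Brown: each `f s` is `i ≫ p` with `p` a fibration and `i` a section of an acyclic fibration
  -- `r`. As `f s` is a weak equivalence, `p` is acyclic too. Acyclic fibrations are closed under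
  -- products, so the products of the `r` and of the `p` are weak equivalences, and two-out-of-three
  -- handles the product of the `i`.
  let h : ∀ s, FibrantBrownFactorization (f s) := fun s => Classical.arbitrary _
  have hr : trivialFibrations C (Limits.Pi.map fun s => (h s).r) :=
    MorphismProperty.limMap _ fun s => mem_trivialFibrations (h s.as).r
  have hp : trivialFibrations C (Limits.Pi.map fun s => (h s).p) :=
    MorphismProperty.limMap _ fun s => mem_trivialFibrations (h s.as).p
  rw [mem_trivialFibrations_iff] at hr hp
  have := hr.2
  have := hp.2
  have : WeakEquivalence (Limits.Pi.map fun s => (h s).i) :=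
    weakEquivalence_of_postcomp_of_fac (g := Limits.Pi.map fun s => (h s).r)
      (fg := 𝟙 _) (by
        refine Limits.Pi.hom_ext _ _ fun s => ?_
        simp)
  have e : Limits.Pi.map f =
      (Limits.Pi.map fun s => (h s).i) ≫ Limits.Pi.map fun s => (h s).p := by
    refine Limits.Pi.hom_ext _ _ fun s => ?_
    simp
  rw [e]
  infer_instance

/-- In a pointed category, each factor of a product of maps is a retract of the product. -/
lemma weakEquivalence_of_piMap [HasZeroMorphisms C] {S : Type w} [HasProductsOfShape S C]
    {X Y : S → C} (f : ∀ s, X s ⟶ Y s) [h : WeakEquivalence (Limits.Pi.map f)] (s : S) :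
    WeakEquivalence (f s) := by
  classical
  rw [weakEquivalence_iff] at h ⊢
  refine MorphismProperty.of_retract (P := weakEquivalences C)
    (g := Limits.Pi.map f) ?_ h
  -- `Pi.ι` is the identity into the factor `s` and zero into the others; this is where zero maps
  -- are needed.
  refine { i := Arrow.homMk (Pi.ι X s) (Pi.ι Y s) ?_
           r := Arrow.homMk (Pi.π X s) (Pi.π Y s) ?_
           retract := ?_ }
  · refine Limits.Pi.hom_ext _ _ fun t => ?_
    by_cases hst : s = t
    · subst hst
      simp
    · simp [Pi.ι_π_of_ne, Pi.ι_π_of_ne_assoc, hst]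
  · simp
  · ext <;> simp

lemma weakEquivalence_app_iff_of_iso {D : Type*} [Category* D] {F G : D ⥤ C} (τ : F ⟶ G)
    {X Y : D} (φ : X ≅ Y) : WeakEquivalence (τ.app X) ↔ WeakEquivalence (τ.app Y) := by
  rw [weakEquivalence_iff, weakEquivalence_iff]
  exact MorphismProperty.arrow_mk_iso_iff _ (Arrow.isoMk' (τ.app X) (τ.app Y) (F.mapIso φ)
    (G.mapIso φ) (τ.naturality φ.hom))

/-- Since `X ≅ X ⨯ ⊤`, the map from `X` to the terminal object is an isomorphism followed by a
projection. -/
lemma isFibrant_of_fibration_snd [HasZeroObject C] [HasZeroMorphisms C]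
    (h : ∀ X Y : C, Fibration (prod.snd : X ⨯ Y ⟶ Y)) (X : C) : IsFibrant X := by
  have := h X (⊤_ C)
  rw [isFibrant_iff]
  have e : terminal.from X = prod.lift (𝟙 X) (terminal.from X) ≫ prod.snd :=
    (prod.lift_snd _ _).symm
  have : IsIso (prod.lift (𝟙 X) (terminal.from X)) :=
    ⟨prod.fst, prod.lift_fst _ _, Limits.prod.hom_ext
      (by rw [Category.assoc, prod.lift_fst, Category.comp_id, Category.id_comp])
      (Subsingleton.elim _ _)⟩
  rw [e]
  infer_instance

end HomotopicalAlgebra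

namespace ConjugatePairs

/-! ### Regular maps of `B` as maps of `U` -/

section RegularMaps

variable {U : Type v} [SmallCategory.{v} U] {I A : MorphismProperty U}
  [I.IsMultiplicative] [A.IsMultiplicative] [AdmitsConjugation I A]

/-- Both backward legs are identities, so an equivalence of the diagrams is forced to be the
identity at the source. Conversely, `Diagram.rel_of_span` supplies the isomorphism between the
middle objects. -/
lemma mk_ofFac_eq_iff {a b c d : U} (p : a ⟶ c) (q : c ⟶ b) (hp : A p) (hq : I q)
    (p' : a ⟶ d) (q' : d ⟶ b) (hp' : A p') (hq' : I q') :
    Quotient.mk (Diagram.setoid I A a b) (Diagram.ofFac I A c p q hp hq) =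
      Quotient.mk (Diagram.setoid I A a b) (Diagram.ofFac I A d p' q' hp' hq') ↔
    p ≫ q = p' ≫ q' := by
  constructor
  · intro h
    obtain ⟨φ, h1, h2⟩ := Diagram.Rel.leg (Quotient.exact h : Diagram.Rel _ _)
    have h3 : φ.hom = 𝟙 a := (Category.comp_id _).symm.trans h1
    have h4 : φ.hom ≫ p' ≫ q' = p ≫ q := h2
    exact h4.symm.trans ((congrArg (fun k : a ⟶ a => k ≫ p' ≫ q') h3).trans
      (Category.id_comp _))
  · intro h
    exact Quotient.sound (Diagram.rel_of_span (Iso.refl a) (Category.id_comp _)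
      ((Category.id_comp _).trans h.symm))

variable (I A) in
/-- The regular map of `B` given by a map of `U`. -/
noncomputable def ofHom {a b : U} (f : a ⟶ b) : (⟨a⟩ : ThreeFold I A) ⟶ ⟨b⟩ :=
  have h := AdmitsConjugation.exists_fac (I := I) (A := A) f
  Quotient.mk _ (Diagram.ofFac I A h.choose h.choose_spec.choose h.choose_spec.choose_spec.choose
    h.choose_spec.choose_spec.choose_spec.1 h.choose_spec.choose_spec.choose_spec.2.1)

/-- The factorization chosen in `ofHom` is immaterial, so any convenient one may be used. -/
lemma ofHom_eq {a b c : U} (p : a ⟶ c) (q : c ⟶ b) (hp : A p) (hq : I q) :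
    ofHom I A (p ≫ q) = Quotient.mk _ (Diagram.ofFac I A c p q hp hq) :=
  have h := AdmitsConjugation.exists_fac (I := I) (A := A) (p ≫ q)
  (mk_ofFac_eq_iff _ _ _ _ _ _ _ _).2 h.choose_spec.choose_spec.choose_spec.2.2

lemma isRegular_ofHom {a b : U} (f : a ⟶ b) : IsRegular (ofHom I A f) :=
  ⟨_, _, _, _, _, rfl⟩

lemma IsRegular.exists_ofHom {a b : ThreeFold I A} {γ : a ⟶ b} (h : IsRegular γ) :
    ∃ f : a.obj ⟶ b.obj, γ = ofHom I A f := by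
  obtain ⟨c, p, q, hp, hq, rfl⟩ := h
  exact ⟨p ≫ q, (ofHom_eq p q hp hq).symm⟩

lemma ofHom_injective {a b : U} {f g : a ⟶ b} (h : ofHom I A f = ofHom I A g) : f = g := by
  obtain ⟨c, p, q, hp, hq, rfl⟩ := AdmitsConjugation.exists_fac (I := I) (A := A) f
  obtain ⟨c', p', q', hp', hq', rfl⟩ := AdmitsConjugation.exists_fac (I := I) (A := A) g
  rw [ofHom_eq p q hp hq, ofHom_eq p' q' hp' hq'] at h
  exact (mk_ofFac_eq_iff _ _ _ _ _ _ _ _).1 h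

lemma inclusion_comp_ofHom {a b : WideSubcategory A} (α : a ⟶ b) {c : U} (f : b.obj ⟶ c) :
    (inclusion I A).map α ≫ ofHom I A f = ofHom I A (α.hom ≫ f) := by
  obtain ⟨m, p, q, hp, hq, rfl⟩ := AdmitsConjugation.exists_fac (I := I) (A := A) f
  rw [ofHom_eq p q hp hq, ← Category.assoc,
    ofHom_eq (α.hom ≫ p) q (A.comp_mem _ _ α.property hp) hq]
  refine Quotient.sound (Diagram.IsSpanComp.unique (Diagram.comp_isSpanComp _ _) ?_)
  refine ⟨𝟙 a.obj, α.hom, ?_, Category.comp_id _, (Category.assoc _ _ _).symm⟩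
  change IsPullback (𝟙 a.obj) α.hom (α.hom ≫ 𝟙 b.obj) (𝟙 b.obj)
  exact IsPullback.of_horiz_isIso ⟨by simp⟩

/-- The element of `U(x, b)₊` given by a map of `U`. -/
noncomputable def regularElement {x : WideSubcategory A} {b : ThreeFold I A}
    (f : x.obj ⟶ b.obj) : {t : (((regularBimodule I A).flip.obj b).obj (op x)).X //
      t ≠ (((regularBimodule I A).flip.obj b).obj (op x)).point} :=
  ⟨some ⟨ofHom I A f, isRegular_ofHom f⟩, Option.some_ne_none _⟩

/-- With injectivity below, this replaces the non-basepoint elements of `U(x, b)₊` by honest maps of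
`U`, free of quotients and options. -/
lemma regularElement_surjective {x : WideSubcategory A} {b : ThreeFold I A} :
    Function.Surjective (regularElement : (x.obj ⟶ b.obj) → _) := by
  rintro ⟨t, ht⟩
  obtain ⟨⟨γ, hγ⟩, rfl⟩ := Option.ne_none_iff_exists'.1 ht
  obtain ⟨f, rfl⟩ := hγ.exists_ofHom
  exact ⟨f, rfl⟩

lemma regularElement_injective {x : WideSubcategory A} {b : ThreeFold I A} :
    Function.Injective (regularElement : (x.obj ⟶ b.obj) → _) := by
  intro f g h
  exact ofHom_injective (congrArg Subtype.val (Option.some_injective _ (congrArg Subtype.val h)))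

/-- Precomposing a regular map with a map of `A` stays inside `U`, so the action of `A` never sends
a regular map to the basepoint, and no zero maps enter the wedge condition of the end. -/
lemma regularBimodule_map_regularElement {x y : WideSubcategory A} (α : x ⟶ y)
    {b : ThreeFold I A} (f : y.obj ⟶ b.obj) :
    (((regularBimodule I A).flip.obj b).map α.op).toFun (regularElement f).1 =
      (regularElement (α.hom ≫ f)).1 := by
  change regularMap α (𝟙 b) (some ⟨ofHom I A f, isRegular_ofHom f⟩) =
    some ⟨ofHom I A (α.hom ≫ f), isRegular_ofHom _⟩
  have e : (inclusion I A).map α ≫ ofHom I A f ≫ 𝟙 b = ofHom I A (α.hom ≫ f) := by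
    rw [← inclusion_comp_ofHom]
    exact congrArg _ (Category.comp_id _)
  have h : IsRegular ((inclusion I A).map α ≫ ofHom I A f ≫ 𝟙 b) := e ▸ isRegular_ofHom _
  exact (dif_pos h).trans (congrArg some (Subtype.ext e))

end RegularMaps

/-! ### Unique decomposition through representatives of maps of `I` -/

section Decomposition

variable {U : Type v} [SmallCategory.{v} U] (I : MorphismProperty U) {A : MorphismProperty U}
  [I.IsMultiplicative] [A.IsMultiplicative] [AdmitsConjugation I A]

/-- A representative of an isomorphism class of maps of `I` with codomain `b`. -/
noncomputable def subobj {b : U} (s : Skeleton (Over (⟨b⟩ : WideSubcategory I))) :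
    Over (⟨b⟩ : WideSubcategory I) :=
  (fromSkeleton _).obj s

variable (A) in
/-- The object of `A` underlying the representative `subobj I s`. -/
noncomputable abbrev subobjSource {b : U}
    (s : Skeleton (Over (⟨b⟩ : WideSubcategory I))) : WideSubcategory A :=
  ⟨(subobj I s).left.obj⟩

/-- `f` is the composite of the map `α` of `A` and the representative of `s`. -/
def IsDecomposition {a : WideSubcategory A} {b : U} (f : a.obj ⟶ b)
    (s : Skeleton (Over (⟨b⟩ : WideSubcategory I)))
    (α : a ⟶ subobjSource I A s) : Prop :=
  α.hom ≫ (subobj I s).hom.hom = f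

/-- The comparison of `q` with its representative is an isomorphism of `I`, hence of `A` by
`iso_mem`, so functors on `A` can be transported along it. -/
lemma exists_subobjSource_iso {a : WideSubcategory A} {b : U} (q : a.obj ⟶ b) (hq : I q) :
    ∃ (s : Skeleton (Over (⟨b⟩ : WideSubcategory I))) (ψ : a ≅ subobjSource I A s),
      IsDecomposition I q s ψ.hom := by
  let o : Over (⟨b⟩ : WideSubcategory I) := Over.mk (wideHom q hq)
  let φ := fromSkeletonToSkeletonIso o
  have e1 : φ.inv.left.hom ≫ φ.hom.left.hom = 𝟙 a.obj :=
    congrArg (fun k => k.left.hom) φ.inv_hom_id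
  have e2 : φ.hom.left.hom ≫ φ.inv.left.hom = 𝟙 _ :=
    congrArg (fun k => k.left.hom) φ.hom_inv_id
  let ψ : a.obj ≅ (subobj I (toSkeleton o)).left.obj := ⟨φ.inv.left.hom, φ.hom.left.hom, e1, e2⟩
  have h := AdmitsConjugation.iso_mem (I := I) (A := A) ψ φ.inv.left.property
    φ.hom.left.property
  have e3 : φ.inv.left.hom ≫ (subobj I (toSkeleton o)).hom.hom = q :=
    congrArg (fun k => k.hom) (Over.w φ.inv)
  exact ⟨toSkeleton o, WideSubcategory.isoMk ψ h.1 h.2, e3⟩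

lemma exists_isDecomposition {a : WideSubcategory A} {b : U} (f : a.obj ⟶ b) :
    ∃ s α, IsDecomposition I f s α := by
  obtain ⟨c, p, q, hp, hq, rfl⟩ := AdmitsConjugation.exists_fac (I := I) (A := A) f
  obtain ⟨s, ψ, h⟩ := exists_subobjSource_iso I (a := (⟨c⟩ : WideSubcategory A)) q hq
  exact ⟨s, ⟨p, hp⟩ ≫ ψ.hom, (Category.assoc _ _ _).trans (congrArg (p ≫ ·) h)⟩

-- Condition (1) makes the two representatives isomorphic over `b`, hence equal in the skeleton; the
-- maps of `A` then agree because maps of `I` can be cancelled. Equality is stated in a sigma type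
-- since the type of `α` depends on `s`.
variable {I} in
lemma IsDecomposition.unique {a : WideSubcategory A} {b : U} {f : a.obj ⟶ b} {s t α β}
    (h : IsDecomposition I f s α) (h' : IsDecomposition I f t β) :
    (⟨s, α⟩ : Σ s : Skeleton (Over (⟨b⟩ : WideSubcategory I)),
      a ⟶ subobjSource I A s) = ⟨t, β⟩ := by
  obtain ⟨φ, h1, h2, -, h4⟩ := AdmitsConjugation.exists_lift (I := I) (A := A) α.hom
    (subobj I s).hom.hom β.hom (subobj I t).hom.hom α.property (subobj I s).hom.property
    β.property (subobj I t).hom.property (h.trans h'.symm)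
  have e : (subobj I t) ≅ (subobj I s) :=
    Over.isoMk ⟨⟨φ.hom, h1⟩, ⟨φ.inv, h2⟩, by ext; exact φ.hom_inv_id, by ext; exact φ.inv_hom_id⟩
      (by ext; exact h4)
  have hst : s = t := by
    rw [← toSkeleton_fromSkeleton_obj s, ← toSkeleton_fromSkeleton_obj t]
    exact toSkeleton_eq_toSkeleton_iff.2 ⟨e.symm⟩
  subst hst
  have : α = β := WideSubcategory.hom_ext _
    (cancel_index (I := I) A _ _ _ (subobj I s).hom.property (h.trans h'.symm))
  rw [this]

end Decomposition

/-! ### The end `RG(b)` as a product -/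

section Evaluation

variable {C : Type u} [Category.{v} C] [HasZeroMorphisms C] [HasLimits C]
  {U : Type v} [SmallCategory.{v} U] {I A : MorphismProperty U}
  [I.IsMultiplicative] [A.IsMultiplicative] [AdmitsConjugation I A]

/-- The component of the end `RG(b)` at a map of `U` with codomain `b`. -/
noncomputable def homEndEval (G : (WideSubcategory A)ᵒᵖ ⥤ C) {x : WideSubcategory A}
    {b : ThreeFold I A} (f : x.obj ⟶ b.obj) :
    homEnd ((regularBimodule I A).flip.obj b) G ⟶ G.obj (op x) :=
  end_.π ((powerBifunctor ((regularBimodule I A).flip.obj b)).obj G) x ≫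
    Pi.π (fun _ => G.obj (op x)) (regularElement f)

lemma homEnd_hom_ext {G : (WideSubcategory A)ᵒᵖ ⥤ C} {b : ThreeFold I A} {Z : C}
    {g h : Z ⟶ homEnd ((regularBimodule I A).flip.obj b) G}
    (H : ∀ (x : WideSubcategory A) (f : x.obj ⟶ b.obj),
      g ≫ homEndEval G f = h ≫ homEndEval G f) : g = h := by
  refine end_.hom_ext fun x => Limits.Pi.hom_ext _ _ fun t => ?_
  obtain ⟨f, rfl⟩ := regularElement_surjective t
  exact (Category.assoc _ _ _).trans ((H x f).trans (Category.assoc _ _ _).symm)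

lemma basedPowerMap_map_π_regularElement {x y : WideSubcategory A} (α : x ⟶ y)
    {b : ThreeFold I A} (f : y.obj ⟶ b.obj) {X Y : C} (g : X ⟶ Y) :
    basedPowerMap g (((regularBimodule I A).flip.obj b).map α.op) ≫
      Pi.π _ (regularElement f) = Pi.π _ (regularElement (α.hom ≫ f)) ≫ g := by
  have e := regularBimodule_map_regularElement α f
  have h : (((regularBimodule I A).flip.obj b).map α.op).toFun (regularElement f).1 ≠
      (((regularBimodule I A).flip.obj b).obj (op x)).point :=
    e ▸ (regularElement (α.hom ≫ f)).2
  rw [basedPowerMap_π_of_ne _ _ _ h]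
  exact congrArg (fun t => Pi.π (fun _ => X) t ≫ g) (Subtype.ext e)

lemma basedPowerMap_id_π {S : Pointed.{v}} {X Y : C} (g : X ⟶ Y)
    (t : {t : S.X // t ≠ S.point}) :
    basedPowerMap g (𝟙 S) ≫ Pi.π _ t = Pi.π _ t ≫ g :=
  basedPowerMap_π_of_ne g (𝟙 S) t t.2

/-- The map `RF(b) ⟶ RG(b)` induced by `τ : F ⟶ G`. -/
noncomputable def homEndMap {F G : (WideSubcategory A)ᵒᵖ ⥤ C} (τ : F ⟶ G) (b : ThreeFold I A) :
    homEnd ((regularBimodule I A).flip.obj b) F ⟶ homEnd ((regularBimodule I A).flip.obj b) G :=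
  ((bimoduleRight (regularBimodule I A)).map τ).app (op b)

/-- This is the wedge condition for `α` read off at the coordinate `f`: one side reindexes the
power, the other applies `G`. -/
lemma homEndEval_comp (G : (WideSubcategory A)ᵒᵖ ⥤ C) {x y : WideSubcategory A} (α : x ⟶ y)
    {b : ThreeFold I A} (f : y.obj ⟶ b.obj) :
    homEndEval G (α.hom ≫ f) = homEndEval G f ≫ G.map α.op := by
  have h := end_.condition ((powerBifunctor ((regularBimodule I A).flip.obj b)).obj G) α =≫
    Pi.π (fun _ => G.obj (op x)) (regularElement f)
  have e1 := basedPowerMap_map_π_regularElement α f (𝟙 (G.obj (op x)))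
  have e2 := basedPowerMap_id_π (G.map α.op) (regularElement f)
  refine Eq.trans ?_ (h.trans ?_)
  · exact Eq.symm ((Category.assoc _ _ _).trans (congrArg (_ ≫ ·) (e1.trans (Category.comp_id _))))
  · exact (Category.assoc _ _ _).trans ((congrArg (_ ≫ ·) e2).trans (Category.assoc _ _ _).symm)

lemma homEndMap_homEndEval {F G : (WideSubcategory A)ᵒᵖ ⥤ C} (τ : F ⟶ G)
    {x : WideSubcategory A} {b : ThreeFold I A} (f : x.obj ⟶ b.obj) :
    homEndMap τ b ≫ homEndEval G f = homEndEval F f ≫ τ.app (op x) := by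
  have h := end_.map_π ((powerBifunctor ((regularBimodule I A).flip.obj b)).map τ) x =≫
    Pi.π (fun _ => G.obj (op x)) (regularElement f)
  have e := basedPowerMap_id_π (τ.app (op x)) (regularElement f)
  refine (Category.assoc _ _ _).symm.trans (h.trans ?_)
  exact (Category.assoc _ _ _).trans ((congrArg (_ ≫ ·) e).trans (Category.assoc _ _ _).symm)

/-- With `homEnd_hom_ext` and `homEndEval_comp`, this gives the working universal property: maps `Z
⟶ RG(b)` are the families indexed by maps of `U` into `b` that are natural over `A`. -/
lemma exists_homEnd_lift (G : (WideSubcategory A)ᵒᵖ ⥤ C) {b : ThreeFold I A} {Z : C}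
    (z : ∀ (x : WideSubcategory A), (x.obj ⟶ b.obj) → (Z ⟶ G.obj (op x)))
    (hz : ∀ (x y : WideSubcategory A) (α : x ⟶ y) (f : y.obj ⟶ b.obj),
      z x (α.hom ≫ f) = z y f ≫ G.map α.op) :
    ∃ g : Z ⟶ homEnd ((regularBimodule I A).flip.obj b) G,
      ∀ (x : WideSubcategory A) (f : x.obj ⟶ b.obj), g ≫ homEndEval G f = z x f := by
  let E : ∀ x : WideSubcategory A, (x.obj ⟶ b.obj) ≃ _ := fun x =>
    Equiv.ofBijective regularElement ⟨regularElement_injective, regularElement_surjective⟩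
  let ζ : ∀ x : WideSubcategory A, Z ⟶ ∏ᶜ fun _ => G.obj (op x) := fun x =>
    Pi.lift fun t => z x ((E x).symm t)
  have hζ : ∀ (x : WideSubcategory A) (f : x.obj ⟶ b.obj),
      ζ x ≫ Pi.π (fun _ => G.obj (op x)) (regularElement f) = z x f := by
    intro x f
    rw [Pi.lift_π]
    exact congrArg (z x) ((E x).symm_apply_apply f)
  refine ⟨end_.lift (F := (powerBifunctor ((regularBimodule I A).flip.obj b)).obj G) ζ ?_, ?_⟩
  · intro x y α
    refine Limits.Pi.hom_ext _ _ fun t => ?_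
    obtain ⟨f, rfl⟩ := regularElement_surjective t
    have e1 := basedPowerMap_map_π_regularElement α f (𝟙 (G.obj (op x)))
    have e2 := basedPowerMap_id_π (G.map α.op) (regularElement f)
    refine (Category.assoc _ _ _).trans ((congrArg (ζ x ≫ ·) (e1.trans (Category.comp_id _))).trans
      ((hζ _ _).trans ((hz _ _ _ _).trans ?_)))
    refine Eq.symm ((Category.assoc _ _ _).trans ((congrArg (ζ y ≫ ·) e2).trans ?_))
    rw [← Category.assoc, hζ]
  · intro x f
    refine Eq.trans ?_ (hζ x f)
    exact (Category.assoc _ _ _).symm.trans (congrArg (· ≫ _) (end_.lift_π _ _ x))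

/-- The comparison of `RG(b)` with the product of the values of `G` at the sources of the maps
of `I` with codomain `b`. -/
noncomputable def homEndToPi (G : (WideSubcategory A)ᵒᵖ ⥤ C) (b : ThreeFold I A) :
    homEnd ((regularBimodule I A).flip.obj b) G ⟶
      ∏ᶜ fun s : Skeleton (Over (⟨b.obj⟩ : WideSubcategory I)) =>
        G.obj (op (subobjSource I A s)) :=
  Pi.lift fun s => homEndEval G (x := subobjSource I A s) (subobj I s).hom.hom

lemma homEndToPi_π (G : (WideSubcategory A)ᵒᵖ ⥤ C) (b : ThreeFold I A)
    (s : Skeleton (Over (⟨b.obj⟩ : WideSubcategory I))) :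
    homEndToPi G b ≫ Pi.π _ s =
      homEndEval G (x := subobjSource I A s) (subobj I s).hom.hom := by
  simp [homEndToPi]

lemma homEndEval_of_isDecomposition (G : (WideSubcategory A)ᵒᵖ ⥤ C) (b : ThreeFold I A)
    {x : WideSubcategory A} {f : x.obj ⟶ b.obj} {s α} (h : IsDecomposition I f s α) :
    homEndEval G f = homEndToPi G b ≫ Pi.π _ s ≫ G.map α.op := by
  rw [← Category.assoc, homEndToPi_π, ← homEndEval_comp]
  exact congrArg _ h.symm

/-- Yoneda for a disjoint union of representables: a natural family is determined by its values at
the representatives, which may be prescribed freely. The inverse has component `π s ≫ G(α)` at a map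
decomposed as `α` followed by `s`. -/
instance isIso_homEndToPi (G : (WideSubcategory A)ᵒᵖ ⥤ C) (b : ThreeFold I A) :
    IsIso (homEndToPi G b) := by
  choose s α hs using fun (x : WideSubcategory A) (f : x.obj ⟶ b.obj) =>
    exists_isDecomposition I f
  let Q : Skeleton (Over (⟨b.obj⟩ : WideSubcategory I)) → C :=
    fun s => G.obj (op (subobjSource I A s))
  -- Uniqueness makes the component independent of the chosen decomposition; naturality of the
  -- family follows by decomposing `β.hom ≫ f` through the representative of `f`.
  have key : ∀ (x : WideSubcategory A) (f : x.obj ⟶ b.obj) (t) (β), IsDecomposition I f t β →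
      Pi.π Q (s x f) ≫ G.map (α x f).op = Pi.π Q t ≫ G.map β.op := by
    intro x f t β h
    exact congrArg (fun p : Σ s : Skeleton (Over (⟨b.obj⟩ : WideSubcategory I)),
      x ⟶ subobjSource I A s => Pi.π Q p.1 ≫ G.map p.2.op) ((hs x f).unique h)
  obtain ⟨g, hg⟩ := exists_homEnd_lift G (b := b) (Z := ∏ᶜ Q)
    (fun x f => Pi.π Q (s x f) ≫ G.map (α x f).op) (by
      intro x y β f
      have h : IsDecomposition I (β.hom ≫ f) (s y f) (β ≫ α y f) :=
        (Category.assoc _ _ _).trans (congrArg (β.hom ≫ ·) (hs y f))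
      rw [key _ _ _ _ h]
      simp)
  refine ⟨g, ?_, ?_⟩
  · refine homEnd_hom_ext fun x f => ?_
    rw [Category.assoc, hg, Category.id_comp, homEndEval_of_isDecomposition G b (hs x f)]
  · refine Limits.Pi.hom_ext _ _ fun t => ?_
    -- A representative decomposes through itself with identity `A`-part.
    rw [Category.assoc, homEndToPi_π, hg, key _ _ t (𝟙 _) (Category.id_comp _), op_id,
      G.map_id, Category.comp_id, Category.id_comp]

/-- Under the comparison `homEndToPi`, the map `Rτ` is a product of components of `τ`. -/
lemma homEndToPi_naturality {F G : (WideSubcategory A)ᵒᵖ ⥤ C} (τ : F ⟶ G)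
    (b : ThreeFold I A) :
    homEndMap τ b ≫ homEndToPi G b =
      homEndToPi F b ≫ Limits.Pi.map fun s => τ.app (op (subobjSource I A s)) := by
  refine Limits.Pi.hom_ext _ _ fun s => ?_
  rw [Category.assoc, homEndToPi_π, homEndMap_homEndEval, Category.assoc, Pi.map_π,
    ← Category.assoc, homEndToPi_π]

end Evaluation

/-! ### Detecting weak equivalences through `R` -/

section WeakEquivalences

variable {C : Type u} [Category.{v} C] [ModelCategory C] [HasLimits C] [HasZeroMorphisms C]
  {U : Type v} [SmallCategory.{v} U] {I A : MorphismProperty U}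
  [I.IsMultiplicative] [A.IsMultiplicative] [AdmitsConjugation I A]
  {F G : (WideSubcategory A)ᵒᵖ ⥤ C} (τ : F ⟶ G)

lemma weakEquivalence_homEndMap_iff_piMap (b : ThreeFold I A) :
    WeakEquivalence (homEndMap τ b) ↔
      WeakEquivalence (Limits.Pi.map fun s : Skeleton (Over (⟨b.obj⟩ : WideSubcategory I)) =>
        τ.app (op (subobjSource I A s))) := by
  rw [weakEquivalence_iff, weakEquivalence_iff]
  exact MorphismProperty.arrow_mk_iso_iff _
    (Arrow.isoMk (asIso (homEndToPi F b)) (asIso (homEndToPi G b))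
      (homEndToPi_naturality τ b).symm)

/-- The map `Rτ` is a weak equivalence if and only if `τ` is, provided all objects are fibrant. -/
lemma weakEquivalence_homEndMap_iff (hC : ∀ X : C, IsFibrant X) :
    (∀ b : ThreeFold I A, WeakEquivalence (homEndMap τ b)) ↔
    ∀ a, WeakEquivalence (τ.app a) := by
  simp only [weakEquivalence_homEndMap_iff_piMap]
  constructor
  · intro h a
    have := h ⟨a.unop.obj⟩
    -- The factor of the product over `a` that belongs to the class of the identity is, up to
    -- isomorphism, the component of `τ` at `a`.
    obtain ⟨s, ψ, -⟩ := exists_subobjSource_iso I (𝟙 a.unop.obj) (I.id_mem _)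
    exact (weakEquivalence_app_iff_of_iso τ ψ.op).1
      (weakEquivalence_of_piMap (fun s => τ.app (op (subobjSource I A s))) s)
  · intro h b
    exact weakEquivalence_piMap _

end WeakEquivalences

end ConjugatePairs

theorem mainTheorem9 {C : Type u} [Category.{v} C] [ModelCategory C] [HasLimits C] [HasColimits C]
    [HasZeroObject C] [HasZeroMorphisms C] [SemiStable.IsSemiStable C]
    {U : Type v} [SmallCategory.{v} U] (I A : MorphismProperty U)
    [I.IsMultiplicative] [A.IsMultiplicative] [ConjugatePairs.AdmitsConjugation I A]
    {B : Type v} [SmallCategory.{v} B] (e : B ≌ ConjugatePairs.ThreeFold I A)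
    {F G : (WideSubcategory A)ᵒᵖ ⥤ C} (τ : F ⟶ G) (hF : IsCofibrant F) :
    WeakEquivalence τ ↔
      WeakEquivalence ((ConjugatePairs.conjugateRight C I A e).map τ) := by
  have hC : ∀ X : C, IsFibrant X :=
    isFibrant_of_fibration_snd (SemiStable.IsSemiStable.standing (C := C)).fibration_snd
  let R := (ConjugatePairs.bimoduleRight (C := C) (ConjugatePairs.regularBimodule I A)).map τ
  have h1 : WeakEquivalence τ ↔ ∀ a, WeakEquivalence (τ.app a) := by
    simp only [weakEquivalence_iff]
    rfl
  have h2 : WeakEquivalence ((ConjugatePairs.conjugateRight C I A e).map τ) ↔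
      ∀ b : B, WeakEquivalence (R.app (op (e.functor.obj b))) := by
    simp only [weakEquivalence_iff]
    exact ⟨fun h b => h (op b), fun h b => h b.unop⟩
  rw [h1, h2, ← ConjugatePairs.weakEquivalence_homEndMap_iff (I := I) τ hC]
  -- Essential surjectivity of `e.functor`: every object of `ThreeFold I A` is isomorphic, through
  -- the counit, to one coming from `B`.
  exact ⟨fun h b => h _, fun h b => (weakEquivalence_app_iff_of_iso R
    (e.counitIso.app b).symm.op).1 (h (e.inverse.obj b))⟩
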